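/- Let $\mathbb F$ be a field of characteristic $0$, let $\mathcal A=\mathbb F[x_1,\dots,x_n]$, and let $V$ be a finite-dimensional irreducible $gl(n)$-module over $\mathbb F$ with highest weight $\mu=(\mu_1,\dots,\mu_n)\in\mathbb F^n$; write $|\mu|=\sum_{i}\mu_i$. Let the vector fields $\sum_i a_i\partial_{x_i}$ ($a_i\in\mathcal A$) act on $\mathcal A\otimes_{\mathbb F}V$ by $$\pi\Big(\sum_{i} a_i\partial_{x_i}\Big)=\sum_{i,j=1}^n\partial_{x_i}(a_j)\otimes E_{i,j}+\sum_{i} a_i\partial_{x_i}\otimes \mathrm{Id}_V .$$ Let $\overline L_n=\sum_{i,j}\mathbb F\,x_i\partial_{x_j}\cong gl(n)$ (with $x_i\partial_{x_j}\leftrightarrow E_{i,j}$), let $p_i=x_i\sum_{k}x_k\partial_{x_k}$, and put $x^{\underline l}=x_1^{l_1}\cdots x_n^{l_n}$, $p^{\underline l}=p_1^{l_1}\cdots p_n^{l_n}$ and $|\underline l|=\sum_i l_i$ for $\underline l\in\mathbb N^n$. For $j\in\mathbb N$ let $(\mathcal A\otimes V)_{\langle j\rangle}$ be the span of all $x^{\underline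 l}\otimes v$ with $|\underline l|=j$ and $v\in V$, let $(U(P)(1\otimes V))_{\langle j\rangle}$ be the span of all $p^{\underline l}.(1\otimes v)$ with $|\underline l|=j$ and $v\in V$, let $$\varphi_j:(\mathcal A\otimes V)_{\langle j\rangle}\to (U(P)(1\otimes V))_{\langle j\rangle},\qquad x^{\underline l}\otimes v\mapsto p^{\underline l}.(1\otimes v),$$ be the induced linear map, and let $$I(\mu,j)=\{\underline c\in\mathbb N^n : |\underline c|=j,\ c_{s+1}\le\mu_s-\mu_{s+1}\ \text{for}\ 1\le s\le n-1\},$$ where the differences $\mu_s-\mu_{s+1}$ are natural numbers. Let $\underline c\in I(\mu,j)$ and let $\xi_{\underline c}\in(\mathcal A\otimes V)_{\langle j\rangle}$ be a maximal vector of weight $\mu+\underline c$ for $\overline L_n$, that is, a non-zero vector such that $x_s\partial_{x_t}.\xi_{\underline c}=0$ for all $s<t$ and $x_s\partial_{x_s}.\xi_{\underline c}=(\mu_s+c_s)\xi_{\underline c}$ for all $s$ (a maximal vector of the component $V(\mu+\underline c)$ of $(\mathcal A\otimes V)_{\langle j\rangle}$). Then $$\varphi_j(\xi_{\underline c})=q_{\underline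 c}\,\xi_{\underline c},\qquad q_{\underline c}=\prod_{s=1}^{n}\prod_{i=1}^{c_s}\big(\mu_s+|\mu|-s+i\big),$$ where empty products are $1$. -/

import Mathlib

open scoped TensorProduct

attribute [local instance] LieRing.ofAssociativeRing

namespace GenProj

noncomputable section

/-- The polynomial algebra `F[x_1, …, x_n]`. -/
abbrev Poly (n : ℕ) (F : Type*) [Field F] : Type _ := MvPolynomial (Fin n) F

/-- The Witt algebra: all derivations of the polynomial algebra, that is, all the
vector fields `∑ i, a_i ∂_i` (with `a_i = D x_i`). -/
abbrev Witt (n : ℕ) (F : Type*) [Field F] : Type _ := Derivation F (Poly n F) (Poly n F)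

/-- The vector field `x_i ∂_j`. -/
def xd (n : ℕ) (F : Type*) [Field F] (i j : Fin n) : Witt n F :=
  (MvPolynomial.X i : Poly n F) • MvPolynomial.pderiv j

/-- The pseudo-translation `p_i = x_i ∑ k, x_k ∂_k`. -/
def pt (n : ℕ) (F : Type*) [Field F] (i : Fin n) : Witt n F :=
  (MvPolynomial.X i : Poly n F) • ∑ k : Fin n, xd n F k k

section Module

variable {n : ℕ} {F : Type*} [Field F]

/-- `v` is a maximal vector of weight `ν` for operators `E i j` on `M` that represent the
matrix units of `gl(n)`: it is non-zero, killed by `E i j` for `i < j`, and of weight `ν`. -/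
structure IsMaximalVector {M : Type*} [AddCommGroup M] [Module F M]
    (E : Fin n → Fin n → Module.End F M) (ν : Fin n → F) (v : M) : Prop where
  ne_zero : v ≠ 0
  raise : ∀ i j : Fin n, i < j → E i j v = 0
  weight : ∀ i : Fin n, E i i v = ν i • v

variable (V : Type*) [AddCommGroup V] [Module F V]
  [LieRingModule (Matrix (Fin n) (Fin n) F) V] [LieModule F (Matrix (Fin n) (Fin n) F) V]

/-- The operator on the `gl(n)`-module `V` given by the matrix unit `E_{i,j}`. -/
def unitOp (i j : Fin n) : Module.End F V :=
  LieModule.toEnd F (Matrix (Fin n) (Fin n) F) V (Matrix.single i j 1)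

/-- The action of the Witt algebra on `F[x] ⊗ V`:
`π(∑ a_i ∂_i) = ∑ i j, ∂_i(a_j) ⊗ E_{i,j} + (∑ a_i ∂_i) ⊗ id`. -/
def wittOp (D : Witt n F) : Module.End F (Poly n F ⊗[F] V) :=
  (∑ i : Fin n, ∑ j : Fin n,
      TensorProduct.map
        (LinearMap.mulLeft F (MvPolynomial.pderiv i (D (MvPolynomial.X j))))
        (unitOp V i j))
    + TensorProduct.map (D : Poly n F →ₗ[F] Poly n F) LinearMap.id

/-- The action on `F[x] ⊗ V` of the copy of `gl(n)` spanned by the `x_i ∂_j`. -/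
def glOp (i j : Fin n) : Module.End F (Poly n F ⊗[F] V) := wittOp V (xd n F i j)

/-- The action of `p^l = p_1^{l_1} ⋯ p_n^{l_n}` on `F[x] ⊗ V`. -/
def pPow (l : Fin n → ℕ) : Module.End F (Poly n F ⊗[F] V) :=
  (List.ofFn fun i : Fin n => wittOp V (pt n F i) ^ l i).prod

/-- The degree-`j` piece of `F[x] ⊗ V`, spanned by the `x^l ⊗ v` with `|l| = j`. -/
def degPiece (j : ℕ) : Submodule F (Poly n F ⊗[F] V) :=
  Submodule.span F
    {t | ∃ (l : Fin n →₀ ℕ) (v : V), ∑ i, l i = j ∧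
      t = (MvPolynomial.monomial l (1 : F) : Poly n F) ⊗ₜ[F] v}

/-- The degree-`j` piece of `U(P)(1 ⊗ V)`, spanned by the `p^l (1 ⊗ v)` with `|l| = j`. -/
def upPiece (j : ℕ) : Submodule F (Poly n F ⊗[F] V) :=
  Submodule.span F
    {t | ∃ (l : Fin n →₀ ℕ) (v : V), ∑ i, l i = j ∧
      t = pPow V l ((1 : Poly n F) ⊗ₜ[F] v)}

/-- The linear map on all of `F[x] ⊗ V` with `x^l ⊗ v ↦ p^l (1 ⊗ v)`. -/
def phiAll : Poly n F ⊗[F] V →ₗ[F] Poly n F ⊗[F] V :=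
  TensorProduct.lift
    ((MvPolynomial.basisMonomials (Fin n) F).constr F fun l =>
      (pPow V l).comp (TensorProduct.mk F (Poly n F) V 1))

theorem phiAll_monomial (l : Fin n →₀ ℕ) (v : V) :
    phiAll V ((MvPolynomial.monomial l (1 : F) : Poly n F) ⊗ₜ[F] v)
      = pPow V l ((1 : Poly n F) ⊗ₜ[F] v) := by
  have h := (MvPolynomial.basisMonomials (Fin n) F).constr_basis F
    (fun l : Fin n →₀ ℕ => (pPow V l).comp (TensorProduct.mk F (Poly n F) V 1)) l
  rw [MvPolynomial.coe_basisMonomials] at h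
  rw [phiAll, TensorProduct.lift.tmul, h]
  rfl

theorem phiAll_mem (j : ℕ) (t : Poly n F ⊗[F] V)
    (ht : t ∈ degPiece (F := F) (n := n) V j) :
    phiAll V t ∈ upPiece (F := F) (n := n) V j := by
  have hle : degPiece (F := F) (n := n) V j ≤ (upPiece V j).comap (phiAll V) := by
    refine Submodule.span_le.2 ?_
    rintro _ ⟨l, v, hl, rfl⟩
    refine Submodule.subset_span ⟨l, v, hl, ?_⟩
    exact phiAll_monomial V l v
  exact hle ht

/-- The map `φ_j` from the degree-`j` piece of `F[x] ⊗ V` to the degree-`j` piece of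
`U(P)(1 ⊗ V)` with `x^l ⊗ v ↦ p^l (1 ⊗ v)`. -/
def phi (j : ℕ) : degPiece (F := F) (n := n) V j →ₗ[F] upPiece (F := F) (n := n) V j :=
  (phiAll V).restrict (phiAll_mem V j)

end Module

/-- The set `I(μ, j)`: all `c ∈ ℕ^n` with `|c| = j` and `c_{s+1} ≤ μ_s - μ_{s+1}`, where
`μ_s - μ_{s+1}` is a natural number. -/
def indexSet {n : ℕ} {F : Type*} [Field F] (μ : Fin n → F) (j : ℕ) : Set (Fin n → ℕ) :=
  {c | ∑ s, c s = j ∧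
    ∀ s t : Fin n, (s : ℕ) + 1 = (t : ℕ) → ∃ m : ℕ, μ s - μ t = (m : F) ∧ c t ≤ m}

/-- `q_c = ∏_s ∏_{i=1}^{c_s} (μ_s + |μ| - s + i)`; positions are counted from `0` in `Fin n`,
hence `s + 1`. -/
def qCoeff {n : ℕ} {F : Type*} [Field F] (μ : Fin n → F) (c : Fin n → ℕ) : F :=
  ∏ s : Fin n, ∏ i ∈ Finset.Icc 1 (c s),
    (μ s + (∑ t : Fin n, μ t) - (((s : ℕ) + 1 : ℕ) : F) + (i : F))

end

end GenProj

/-!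
For `D` a vector field write `D` also for its operator on `F[x] ⊗ V`, let `e_{ab}` be the operators
of the `x_a ∂_b`, `C = ∑ e_{ab} e_{ba}` their Casimir operator and `m = |μ|`, the scalar by which
the identity matrix acts on `V`. A computation of the commutator `[C, x_i]` gives
`2 p_i = [C, x_i] + (2 m - n) x_i` (`two_smul_wittOp_pt`). The `p_i` commute, so that
`φ (x_i t) = p_i φ(t)` for the map `φ : x^l ⊗ v ↦ p^l (1 ⊗ v)` (`phiAll_mulOp`); since `C` is
central, `φ` commutes with all the `e_{ab}` (`phiAll_glOp`).

The eigenvalue is found by induction on the degree `j`, from `j ξ = ∑ x_i ∂_i ξ` and hence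
`j φ(ξ) = ∑ p_i φ(∂_i ξ)`. Put `λ = μ + c`, with positions
counted from `1`. Under the upper triangular matrices the `∂_i ξ` transform like the dual of the
standard representation tensored with a maximal vector of weight `λ` (`IsDualFamily`), so `C` acts
on them triangularly, with diagonal entries the Casimir values of the weights `λ - ε_r`. These are
distinct because `λ` is dominant (`casimirValue_injective`), and Lagrange interpolation splits
`∂_i ξ = ∑_r u_{r,i}` into eigenvectors of `C` (`IsDualFamily.exists_splitting`). No complete
reducibility is needed: for each `r` the vector `u_{r,r}` is zero or maximal of weight `λ - ε_r`,
and any equivariant operator that kills it kills all the `u_{r,i}` (`IsDualFamily.eq_zero`). If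
`c_r > 0`, then by induction `φ` acts on all the `u_{r,i}` by `q_{c - ε_r}`. If `c_r = 0` they
vanish, since every maximal vector of `F[x] ⊗ V` has a weight in `μ + ℕ^n`
(`IsMaximalVector.exists_weight_eq`). Finally `∑_i x_i u_{r,i}` has the Casimir eigenvalue of `λ`,
so the formula for `p_i` gives `∑_i p_i u_{r,i} = (λ_r + m - r) ∑_i x_i u_{r,i}`
(`IsDualFamily.sum_wittOp_pt`), and the factor is `q_c / q_{c - ε_r}` (`qCoeff_add_single`). Every
`r` thus contributes the same multiple `q_c`.
-/

namespace GenProj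

/-! ### The Casimir operator of `gl(n)` and dual families -/

section Casimir

variable {n : ℕ} {F : Type*} [Field F] {M : Type*} [AddCommGroup M] [Module F M]

/-- The commutation relations of the matrix units of `gl(n)`, for operators `e a b` on `M`. -/
def IsGlRep (e : Fin n → Fin n → Module.End F M) : Prop :=
  ∀ a b c d, e a b * e c d =
    e c d * e a b + ((if b = c then e a d else 0) - (if d = a then e c b else 0))

/-- The quadratic Casimir operator `∑ a b, e_{ab} e_{ba}` of `gl(n)`. -/
noncomputable def casimir (e : Fin n → Fin n → Module.End F M) : Module.End F M :=
  ∑ a, ∑ b, e a b * e b a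

/-- The eigenvalue of the Casimir operator on a maximal vector of weight `ν`. Positions are
counted from `0`. -/
def casimirValue (ν : Fin n → F) : F :=
  ∑ a, ν a * (ν a + (n - 1 - 2 * ((a : ℕ) : F)))

theorem IsGlRep.commute_casimir {e : Fin n → Fin n → Module.End F M} (he : IsGlRep e)
    (c d : Fin n) : Commute (e c d) (casimir e) := by
  have h : ∀ a b, e c d * (e a b * e b a) - (e a b * e b a) * e c d =
      ((if d = a then e c b * e b a else 0) - (if b = c then e a d * e b a else 0)) +
      ((if d = b then e a b * e c a else 0) - (if a = c then e a b * e b d else 0)) := by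
    intro a b
    have h1 := he c d a b
    have h2 := he c d b a
    have : e c d * (e a b * e b a) - (e a b * e b a) * e c d =
      (e c d * e a b - e a b * e c d) * e b a + e a b * (e c d * e b a - e b a * e c d) := by
      noncomm_ring
    rw [this, h1, h2, add_sub_cancel_left, add_sub_cancel_left, sub_mul, mul_sub]
    simp only [ite_mul, mul_ite, zero_mul, mul_zero]
  rw [commute_iff_lie_eq, Ring.lie_def, casimir, Finset.mul_sum, Finset.sum_mul,
    ← Finset.sum_sub_distrib]
  simp only [Finset.mul_sum, Finset.sum_mul, ← Finset.sum_sub_distrib, h]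
  simp only [Finset.sum_add_distrib, Finset.sum_sub_distrib]
  simp only [Finset.sum_ite_eq, Finset.mem_univ, if_true, Finset.sum_ite_eq']
  rw [Finset.sum_comm (f := fun a b => if d = a then e c b * e b a else 0)]
  rw [Finset.sum_comm (f := fun a b => if a = c then e a b * e b d else 0)]
  simp only [Finset.sum_ite_eq, Finset.mem_univ, if_true, Finset.sum_ite_eq']
  abel

theorem commute_casimir_of_commute {e : Fin n → Fin n → Module.End F M} {f : Module.End F M}
    (hf : ∀ a b, Commute f (e a b)) : Commute f (casimir e) :=
  Commute.sum_right _ _ _ fun a _ => Commute.sum_right _ _ _ fun b _ =>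
    (hf a b).mul_right (hf b a)

open Polynomial in
theorem commute_aeval {f g : Module.End F M} (h : Commute f g) (p : F[X]) :
    Commute f (aeval g p) := by
  induction p using Polynomial.induction_on' with
  | add p q hp hq => rw [map_add]; exact hp.add_right hq
  | monomial k a =>
    rw [aeval_monomial]
    exact (Algebra.commute_algebraMap_right a f).mul_right (h.pow_right k)

theorem casimirValue_sub_single (ν : Fin n → F) (r : Fin n) :
    casimirValue (fun s => ν s - if r = s then 1 else 0)
      = casimirValue ν - (2 * ν r + (n : F) - 2 * (((r : ℕ) : F) + 1)) := by
  unfold casimirValue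
  have h : ∀ s : Fin n, (ν s - if r = s then 1 else 0) *
      ((ν s - if r = s then 1 else 0) + (n - 1 - 2 * ((s : ℕ) : F))) =
      ν s * (ν s + (n - 1 - 2 * ((s : ℕ) : F))) -
        if r = s then 2 * ν s + (n : F) - 2 * (((s : ℕ) : F) + 1) else 0 := by
    intro s
    split_ifs <;> ring
  simp only [h, Finset.sum_sub_distrib, Finset.sum_ite_eq, Finset.mem_univ, if_true]

theorem sum_lt_sub_eq (ν : Fin n → F) :
    ∑ a : Fin n, ∑ b : Fin n, (if a < b then ν a - ν b else 0)
      = ∑ a, ν a * (n - 1 - 2 * ((a : ℕ) : F)) := by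
  have h1 : ∀ a b : Fin n, (if a < b then ν a - ν b else 0) =
      (if a < b then ν a else 0) - (if a < b then ν b else 0) := by
    intro a b; split_ifs <;> simp
  simp only [h1, Finset.sum_sub_distrib]
  rw [Finset.sum_comm (f := fun a b : Fin n => if a < b then ν b else 0),
    ← Finset.sum_sub_distrib]
  refine Finset.sum_congr rfl fun a _ => ?_
  rw [← Finset.sum_filter, ← Finset.sum_filter, Finset.sum_const, Finset.sum_const,
    Finset.filter_lt_eq_Ioi, Finset.filter_gt_eq_Iio, Fin.card_Ioi, Fin.card_Iio,
    nsmul_eq_mul, nsmul_eq_mul, Nat.sub_sub, Nat.cast_sub (by omega)]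
  push_cast
  ring

/-- Moving the raising operators to the right expresses the Casimir operator on a weight vector
through its weight and the vectors obtained from it by raising. -/
theorem IsGlRep.casimir_apply {e : Fin n → Fin n → Module.End F M} (he : IsGlRep e)
    {ν : Fin n → F} {w : M} (hw : ∀ s, e s s w = ν s • w) :
    casimir e w = casimirValue ν • w
      + (2 : F) • ∑ a, ∑ b, (if a < b then e b a (e a b w) else 0) := by
  have h : ∀ a b, e a b (e b a w) =
      ((if a < b then e b a (e a b w) else 0) + (if b < a then e a b (e b a w) else 0))
      + ((if a = b then (ν a * ν a) • w else 0) + (if a < b then ν a - ν b else 0) • w) := by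
    intro a b
    rcases lt_trichotomy a b with hab | rfl | hab
    · have := LinearMap.congr_fun (he a b b a) w
      simp only [Module.End.mul_apply, LinearMap.add_apply, LinearMap.sub_apply, if_true, hw]
        at this
      simp [hab, hab.ne, not_lt_of_gt hab, this, sub_smul]
    · simp [hw, smul_smul]
    · simp [hab, hab.ne', not_lt_of_gt hab]
  have h2 : casimir e w = ∑ a, ∑ b, e a b (e b a w) := by
    simp [casimir, LinearMap.sum_apply]
  rw [h2]
  rw [Finset.sum_congr rfl fun a _ => Finset.sum_congr rfl fun b _ => h a b]
  simp only [Finset.sum_add_distrib]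
  rw [Finset.sum_comm (f := fun a b => if b < a then e a b (e b a w) else 0)]
  have h3 : ∑ a, ∑ b, (if a < b then ν a - ν b else 0) • w
      = (∑ a, ν a * (n - 1 - 2 * ((a : ℕ) : F))) • w := by
    rw [← sum_lt_sub_eq, Finset.sum_smul]
    exact Finset.sum_congr rfl fun a _ => (Finset.sum_smul ..).symm
  have h4 : ∑ a, ∑ b, (if a = b then (ν a * ν a) • w else 0) = (∑ a, ν a * ν a) • w := by
    rw [Finset.sum_smul]
    exact Finset.sum_congr rfl fun a _ => by simp
  have h5 : casimirValue ν = (∑ a, ν a * ν a) + ∑ a, ν a * (n - 1 - 2 * ((a : ℕ) : F)) := by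
    simp only [casimirValue, mul_add, Finset.sum_add_distrib]
  rw [h3, h4, h5, add_smul, two_smul]
  abel

theorem IsGlRep.casimir_apply_maximal {e : Fin n → Fin n → Module.End F M} (he : IsGlRep e)
    {ν : Fin n → F} {w : M} (hw : ∀ s, e s s w = ν s • w)
    (hr : ∀ s t, s < t → e s t w = 0) : casimir e w = casimirValue ν • w := by
  rw [he.casimir_apply hw]
  have : ∀ a b, (if a < b then e b a (e a b w) else 0) = 0 := by
    intro a b
    split_ifs with h
    · rw [hr a b h, map_zero]
    · rfl
  simp [this]

/-- A family `d i` of vectors that transforms under the Borel subalgebra like `ε_i^* ⊗ w`, for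
the dual `ε_i^*` of the standard basis and a maximal vector `w` of weight `ν`. -/
structure IsDualFamily (e : Fin n → Fin n → Module.End F M) (ν : Fin n → F) (d : Fin n → M) :
    Prop where
  raise : ∀ i s t, s < t → e s t (d i) = -(if i = s then d t else 0)
  weight : ∀ i s, e s s (d i) = (ν s - if i = s then 1 else 0) • d i

namespace IsDualFamily

variable {e : Fin n → Fin n → Module.End F M} {ν : Fin n → F} {d : Fin n → M}

theorem map (h : IsDualFamily e ν d) {f : Module.End F M} (hf : ∀ a b, Commute (e a b) f) :
    IsDualFamily e ν (fun i => f (d i)) := by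
  have hc : ∀ a b x, e a b (f x) = f (e a b x) := fun a b x => LinearMap.congr_fun (hf a b).eq x
  constructor
  · intro i s t hst
    rw [hc, h.raise i s t hst, map_neg, apply_ite f, map_zero]
  · intro i s
    rw [hc, h.weight, map_smul]

/-- The Casimir operator acts triangularly on a dual family. -/
theorem casimir_apply (h : IsDualFamily e ν d) (he : IsGlRep e) (i : Fin n) :
    casimir e (d i) = casimirValue (fun s => ν s - if i = s then 1 else 0) • d i
      - (2 : F) • ∑ t ∈ Finset.Ioi i, e t i (d t) := by
  rw [he.casimir_apply (h.weight i), sub_eq_add_neg, ← smul_neg]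
  congr 2
  have h1 : ∀ a b, (if a < b then e b a (e a b (d i)) else 0)
      = if i = a then (if i < b then - e b i (d b) else 0) else 0 := by
    intro a b
    by_cases hia : i = a
    · subst hia
      by_cases hab : i < b
      · simp [hab, h.raise i i b hab]
      · simp [hab]
    · by_cases hab : a < b
      · simp [hab, hia, h.raise i a b hab]
      · simp [hab, hia]
  simp only [h1]
  rw [Finset.sum_comm]
  simp only [Finset.sum_ite_eq, Finset.mem_univ, if_true]
  rw [← Finset.sum_filter, Finset.filter_lt_eq_Ioi, Finset.sum_neg_distrib]

/-- If the Casimir operator acts on a dual family by the scalar belonging to position `r`, then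
a member at another position vanishes as soon as all the later ones do: it would be a maximal
vector with the wrong Casimir eigenvalue. -/
theorem eq_zero_of_later (h : IsDualFamily e ν d) (he : IsGlRep e)
    (hν : Function.Injective fun i : Fin n =>
      casimirValue (fun s => ν s - if i = s then 1 else 0))
    {r : Fin n}
    (hC : ∀ i, casimir e (d i) = casimirValue (fun s => ν s - if r = s then 1 else 0) • d i)
    {i : Fin n} (hi : ∀ t, i < t → d t = 0) (hir : i ≠ r) : d i = 0 := by
  have h1 := h.casimir_apply he i
  rw [Finset.sum_eq_zero (fun t ht => by rw [hi t (Finset.mem_Ioi.1 ht), map_zero]), smul_zero,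
    sub_zero, hC i, ← sub_eq_zero, ← sub_smul] at h1
  exact (smul_eq_zero.1 h1).resolve_left (sub_ne_zero.2 fun h2 => hir (hν h2).symm)

theorem eq_zero_of_gt (h : IsDualFamily e ν d) (he : IsGlRep e)
    (hν : Function.Injective fun i : Fin n =>
      casimirValue (fun s => ν s - if i = s then 1 else 0))
    {r : Fin n}
    (hC : ∀ i, casimir e (d i) = casimirValue (fun s => ν s - if r = s then 1 else 0) • d i)
    (i : Fin n) (hi : r < i) : d i = 0 := by
  induction i using WellFoundedGT.induction with
  | ind i ih =>
    exact h.eq_zero_of_later he hν hC (fun t ht => ih t ht (hi.trans ht)) hi.ne'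

theorem eq_zero (h : IsDualFamily e ν d) (he : IsGlRep e)
    (hν : Function.Injective fun i : Fin n =>
      casimirValue (fun s => ν s - if i = s then 1 else 0))
    {r : Fin n}
    (hC : ∀ i, casimir e (d i) = casimirValue (fun s => ν s - if r = s then 1 else 0) • d i)
    (hr : d r = 0) (i : Fin n) : d i = 0 := by
  induction i using WellFoundedGT.induction with
  | ind i ih =>
    by_cases hir : i = r
    · rw [hir, hr]
    · exact h.eq_zero_of_later he hν hC ih hir

open Polynomial in
theorem aeval_casimir_prod_eq_zero (h : IsDualFamily e ν d) (he : IsGlRep e) (i : Fin n) :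
    aeval (casimir e) (∏ s ∈ Finset.Ici i,
      (X - C (casimirValue (fun t => ν t - if s = t then 1 else 0)))) (d i) = 0 := by
  induction i using WellFoundedGT.induction with
  | ind i ih =>
    have h1 : aeval (casimir e)
        (X - C (casimirValue (fun t => ν t - if i = t then 1 else 0))) (d i)
        = -((2 : F) • ∑ t ∈ Finset.Ioi i, e t i (d t)) := by
      simp only [map_sub, aeval_X, aeval_C, LinearMap.sub_apply, Module.algebraMap_end_apply,
        h.casimir_apply he i]
      abel
    rw [← Finset.Ioi_insert, Finset.prod_insert (by simp), mul_comm, map_mul,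
      Module.End.mul_apply, h1, map_neg, map_smul, map_sum, Finset.sum_eq_zero, smul_zero,
      neg_zero]
    intro t ht
    have hcomm := LinearMap.congr_fun (commute_aeval (he.commute_casimir t i)
      (∏ s ∈ Finset.Ioi i, (X - C (casimirValue (fun t => ν t - if s = t then 1 else 0))))).eq
      (d t)
    simp only [Module.End.mul_apply] at hcomm
    rw [← hcomm]
    have hsub : Finset.Ici t ⊆ Finset.Ioi i := fun s hs =>
      Finset.mem_Ioi.2 (lt_of_lt_of_le (Finset.mem_Ioi.1 ht) (Finset.mem_Ici.1 hs))
    rw [← Finset.prod_sdiff hsub, map_mul, Module.End.mul_apply, ih t (Finset.mem_Ioi.1 ht),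
      map_zero, map_zero]

open Polynomial in
/-- A dual family whose Casimir values are distinct splits into dual families on which the
Casimir operator is scalar; the projections are Lagrange polynomials in the Casimir operator. -/
theorem exists_splitting (h : IsDualFamily e ν d) (he : IsGlRep e)
    (hν : Function.Injective fun i : Fin n =>
      casimirValue (fun s => ν s - if i = s then 1 else 0)) :
    ∃ P : Fin n → F[X], (∀ i, ∑ r, aeval (casimir e) (P r) (d i) = d i) ∧
      ∀ r i, casimir e (aeval (casimir e) (P r) (d i)) =
        casimirValue (fun s => ν s - if r = s then 1 else 0) •
          aeval (casimir e) (P r) (d i) := by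
  set γ : Fin n → F := fun i => casimirValue (fun s => ν s - if i = s then 1 else 0)
  refine ⟨fun r => Lagrange.basis Finset.univ γ r, fun i => ?_, fun r i => ?_⟩
  · have h1 := Lagrange.sum_basis (s := Finset.univ) (v := γ) hν.injOn ⟨i, Finset.mem_univ i⟩
    have h2 := congrArg (fun p => aeval (casimir e) p (d i)) h1
    simpa [LinearMap.sum_apply] using h2
  · have h1 : aeval (casimir e) (∏ s, (X - C (γ s))) (d i) = 0 := by
      rw [← Finset.prod_sdiff (Finset.subset_univ (Finset.Ici i)), map_mul,
        Module.End.mul_apply, h.aeval_casimir_prod_eq_zero he i, map_zero]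
    have h2 : (X - C (γ r)) * Lagrange.basis Finset.univ γ r
        = (∏ j ∈ Finset.univ.erase r, C ((γ r - γ j)⁻¹)) * ∏ s, (X - C (γ s)) := by
      rw [Lagrange.basis, ← Finset.mul_prod_erase Finset.univ _ (Finset.mem_univ r)]
      simp only [Lagrange.basisDivisor, Finset.prod_mul_distrib]
      ring
    have h3 := congrArg (fun p => aeval (casimir e) p (d i)) h2
    simp only [map_mul, Module.End.mul_apply, h1, map_zero] at h3
    simpa [sub_eq_zero] using h3

end IsDualFamily

end Casimir

/-! ### Maximal vectors of irreducible modules -/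

section Irreducible

variable {n : ℕ} {F : Type*} [Field F] (V : Type*) [AddCommGroup V] [Module F V]
  [LieRingModule (Matrix (Fin n) (Fin n) F) V] [LieModule F (Matrix (Fin n) (Fin n) F) V]

theorem isGlRep_unitOp : IsGlRep (unitOp (n := n) (F := F) V) := by
  intro a b c d
  rw [← sub_eq_iff_eq_add', ← Ring.lie_def]
  simp only [unitOp]
  rw [← LieHom.map_lie, Ring.lie_def]
  by_cases hbc : b = c <;> by_cases hda : d = a
  · subst hbc hda; simp
  · subst hbc
    simp [hda, Matrix.single_mul_single_of_ne _ _ _ _ hda]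
  · subst hda
    simp [hbc, Matrix.single_mul_single_of_ne _ _ _ _ hbc]
  · simp [hbc, hda, Matrix.single_mul_single_of_ne _ _ _ _ hda,
      Matrix.single_mul_single_of_ne _ _ _ _ hbc]

variable {V}

theorem unitOp_apply_unitOp (a b c d : Fin n) (v : V) :
    unitOp (n := n) (F := F) V a b (unitOp (n := n) (F := F) V c d v) =
      unitOp (n := n) (F := F) V c d (unitOp (n := n) (F := F) V a b v) +
      ((if b = c then unitOp (n := n) (F := F) V a d v else 0) -
        (if d = a then unitOp (n := n) (F := F) V c b v else 0)) := by
  have := LinearMap.congr_fun (isGlRep_unitOp (n := n) (F := F) V a b c d) v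
  simp only [Module.End.mul_apply, LinearMap.add_apply, LinearMap.sub_apply] at this
  rw [this]
  split_ifs <;> simp

/-- The operator `∑ i, i E_{ii}`; the matrix unit `E_{ab}` shifts its eigenvalues by `a - b`. -/
noncomputable def heightOp (n : ℕ) (F : Type*) [Field F] (V : Type*) [AddCommGroup V] [Module F V]
    [LieRingModule (Matrix (Fin n) (Fin n) F) V] [LieModule F (Matrix (Fin n) (Fin n) F) V] :
    Module.End F V :=
  ∑ i : Fin n, ((i : ℕ) : F) • unitOp (n := n) (F := F) V i i

theorem heightOp_unitOp (a b : Fin n) (v : V) :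
    heightOp n F V (unitOp (n := n) (F := F) V a b v) =
      unitOp (n := n) (F := F) V a b (heightOp n F V v) +
        (((a : ℕ) : F) - ((b : ℕ) : F)) • unitOp (n := n) (F := F) V a b v := by
  simp only [heightOp, LinearMap.sum_apply, LinearMap.smul_apply, map_sum, map_smul,
    unitOp_apply_unitOp _ _ a b v, smul_add, Finset.sum_add_distrib, smul_sub,
    Finset.sum_sub_distrib, smul_ite, smul_zero]
  simp [sub_smul]

theorem heightOp_of_weight {ν : Fin n → F} {v : V}
    (hw : ∀ i, unitOp (n := n) (F := F) V i i v = ν i • v) :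
    heightOp n F V v = (∑ i : Fin n, ((i : ℕ) : F) * ν i) • v := by
  simp [heightOp, LinearMap.sum_apply, hw, smul_smul, Finset.sum_smul]

theorem unitOp_mem_eigenspace {a b : Fin n} (hab : b ≤ a) {η : F} {v : V}
    (hv : heightOp n F V v = η • v) :
    unitOp (n := n) (F := F) V a b v ∈
      Module.End.eigenspace (heightOp n F V) (η + ((a - b : ℕ) : F)) := by
  rw [Module.End.mem_eigenspace_iff, heightOp_unitOp, hv, map_smul,
    Nat.cast_sub (Fin.le_def.1 hab), add_smul]

variable [LieModule.IsIrreducible F (Matrix (Fin n) (Fin n) F) V]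

theorem eq_top_of_unitOp_mem {W : Submodule F V} (hW : W ≠ ⊥)
    (h : ∀ a b, ∀ w ∈ W, unitOp (n := n) (F := F) V a b w ∈ W) : W = ⊤ := by
  let N : LieSubmodule F (Matrix (Fin n) (Fin n) F) V :=
    { W with
      lie_mem := by
        intro x w hw
        rw [Matrix.matrix_eq_sum_single x]
        simp only [sum_lie]
        refine Submodule.sum_mem _ fun a _ => Submodule.sum_mem _ fun b _ => ?_
        have := W.smul_mem (x a b) (h a b w hw)
        rwa [unitOp, LieModule.toEnd_apply_apply, ← smul_lie, Matrix.smul_single, smul_eq_mul,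
          mul_one] at this }
  have hN : N ≠ ⊥ := by
    intro h0
    apply hW
    have := congrArg LieSubmodule.toSubmodule h0
    simpa [N] using this
  have h1 : N = ⊤ := (eq_bot_or_eq_top N).resolve_left hN
  have := congrArg LieSubmodule.toSubmodule h1
  simpa [N] using this

/-- The identity matrix acts on an irreducible module with a vector of weight `μ` by `|μ|`. -/
theorem sum_unitOp_self {μ : Fin n → F} {v : V} (hv : v ≠ 0)
    (hw : ∀ i, unitOp (n := n) (F := F) V i i v = μ i • v) (x : V) :
    ∑ i, unitOp (n := n) (F := F) V i i x = (∑ i, μ i) • x := by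
  have htop := eq_top_of_unitOp_mem (n := n) (F := F) (V := V)
    (W := LinearMap.ker ((∑ i, unitOp (n := n) (F := F) V i i) - (∑ i, μ i) • LinearMap.id)) ?_ ?_
  · have hx : x ∈ LinearMap.ker
        ((∑ i, unitOp (n := n) (F := F) V i i) - (∑ i, μ i) • LinearMap.id) := by
      rw [htop]; trivial
    simpa [sub_eq_zero, LinearMap.sum_apply] using hx
  · intro h0
    have hmem : v ∈ LinearMap.ker
        ((∑ i, unitOp (n := n) (F := F) V i i) - (∑ i, μ i) • LinearMap.id) := by
      simp [LinearMap.sum_apply, hw, Finset.sum_smul]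
    rw [h0] at hmem
    exact hv (by simpa using hmem)
  · intro a b w hw
    simp only [LinearMap.mem_ker, LinearMap.sub_apply, LinearMap.sum_apply, LinearMap.smul_apply,
      LinearMap.id_apply, sub_eq_zero] at hw ⊢
    rw [← map_smul, ← hw, map_sum]
    simp only [unitOp_apply_unitOp _ _ a b w, Finset.sum_add_distrib, Finset.sum_sub_distrib]
    simp

/-- In an irreducible module, a maximal vector generates everything under the lower triangular
Borel subalgebra. -/
theorem eq_top_of_lowering_mem {ν : Fin n → F} {v : V}
    (hv : IsMaximalVector (unitOp (n := n) (F := F) V) ν v)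
    {W : Submodule F V} (hvW : v ∈ W)
    (hW : ∀ a b, b ≤ a → ∀ w ∈ W, unitOp (n := n) (F := F) V a b w ∈ W) : W = ⊤ := by
  -- `B` is the submodule generated by `v` under lowering, and `B'` the part of it that all
  -- the matrix units map into `B`.
  let B : Submodule F V :=
    sInf {U | v ∈ U ∧ ∀ a b, b ≤ a → ∀ w ∈ U, unitOp (n := n) (F := F) V a b w ∈ U}
  have hvB : v ∈ B := Submodule.mem_sInf.2 fun U hU => hU.1
  have hB : ∀ a b, b ≤ a → ∀ w ∈ B, unitOp (n := n) (F := F) V a b w ∈ B := fun a b hab w hw =>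
    Submodule.mem_sInf.2 fun U hU => hU.2 a b hab w (Submodule.mem_sInf.1 hw U hU)
  let B' : Submodule F V := B ⊓ ⨅ s, ⨅ t, B.comap (unitOp (n := n) (F := F) V s t)
  have hmem : ∀ w, w ∈ B' ↔ w ∈ B ∧ ∀ s t, unitOp (n := n) (F := F) V s t w ∈ B := by
    intro w
    simp [B', Submodule.mem_inf, Submodule.mem_iInf, Submodule.mem_comap]
  have hle : B ≤ B' := by
    refine sInf_le ⟨(hmem v).2 ⟨hvB, fun s t => ?_⟩, fun a b hab w hw => ?_⟩
    · rcases lt_or_ge s t with hst | hst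
      · rw [hv.raise s t hst]; exact B.zero_mem
      · exact hB s t hst v hvB
    · obtain ⟨hwB, hw2⟩ := (hmem w).1 hw
      refine (hmem _).2 ⟨hB a b hab w hwB, fun s t => ?_⟩
      rw [unitOp_apply_unitOp]
      refine B.add_mem (hB a b hab _ (hw2 s t)) (B.sub_mem ?_ ?_)
      · split_ifs
        · exact hw2 _ _
        · exact B.zero_mem
      · split_ifs
        · exact hw2 _ _
        · exact B.zero_mem
  have htop : B = ⊤ := eq_top_of_unitOp_mem (n := n) (F := F)
    (fun h => hv.ne_zero (by rw [h] at hvB; simpa using hvB))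
    (fun a b w hw => ((hmem w).1 (hle hw)).2 a b)
  exact top_le_iff.1 (htop ▸ sInf_le ⟨hvW, hW⟩)

/-- An irreducible module is spanned by a maximal vector together with vectors of strictly
greater height. -/
theorem span_sup_eigenspace_eq_top {ν : Fin n → F} {v : V}
    (hv : IsMaximalVector (unitOp (n := n) (F := F) V) ν v) :
    Submodule.span F {v} ⊔ ⨆ k : ℕ, Module.End.eigenspace (heightOp n F V)
      ((∑ i : Fin n, ((i : ℕ) : F) * ν i) + (k + 1 : ℕ)) = ⊤ := by
  set η := ∑ i : Fin n, ((i : ℕ) : F) * ν i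
  refine eq_top_of_lowering_mem hv
    (Submodule.mem_sup_left (Submodule.mem_span_singleton_self v)) ?_
  intro a b hab
  suffices h : Submodule.span F {v} ⊔ ⨆ k : ℕ, Module.End.eigenspace (heightOp n F V)
      (η + (k + 1 : ℕ)) ≤ (Submodule.span F {v} ⊔ ⨆ k : ℕ, Module.End.eigenspace
      (heightOp n F V) (η + (k + 1 : ℕ))).comap (unitOp (n := n) (F := F) V a b) from
    fun w hw => h hw
  refine sup_le ?_ (iSup_le fun k => ?_)
  · rw [Submodule.span_singleton_le_iff_mem, Submodule.mem_comap]
    rcases hab.eq_or_lt with rfl | hlt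
    · rw [hv.weight]
      exact Submodule.mem_sup_left (Submodule.smul_mem _ _ (Submodule.mem_span_singleton_self v))
    · have h1 := unitOp_mem_eigenspace hab (heightOp_of_weight hv.weight)
      have h2 : ((a : ℕ) - b : ℕ) = ((a : ℕ) - b - 1) + 1 := by
        have := Fin.lt_def.1 hlt; omega
      rw [h2] at h1
      exact Submodule.mem_sup_right (Submodule.mem_iSup_of_mem _ h1)
  · intro w hw
    have h1 := unitOp_mem_eigenspace hab (Module.End.mem_eigenspace_iff.1 hw)
    rw [add_assoc, ← Nat.cast_add, add_right_comm] at h1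
    exact Submodule.mem_sup_right (Submodule.mem_iSup_of_mem _ h1)

theorem IsMaximalVector.exists_height_eq {μ ν : Fin n → F} {u v : V}
    (hu : IsMaximalVector (unitOp (n := n) (F := F) V) μ u)
    (hv : IsMaximalVector (unitOp (n := n) (F := F) V) ν v) :
    ∃ k : ℕ, ∑ i : Fin n, ((i : ℕ) : F) * μ i = (∑ i : Fin n, ((i : ℕ) : F) * ν i) + k := by
  by_contra! hne
  set η := ∑ i : Fin n, ((i : ℕ) : F) * μ i
  set ζ := ∑ i : Fin n, ((i : ℕ) : F) * ν i
  have hle : Submodule.span F {v} ⊔ ⨆ k : ℕ, Module.End.eigenspace (heightOp n F V)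
      (ζ + (k + 1 : ℕ)) ≤ ⨆ θ, ⨆ _ : θ ≠ η, Module.End.eigenspace (heightOp n F V) θ := by
    refine sup_le ?_ (iSup_le fun k => ?_)
    · rw [Submodule.span_singleton_le_iff_mem]
      exact Submodule.mem_iSup_of_mem ζ (Submodule.mem_iSup_of_mem
        (fun h => hne 0 (by simp [h])) (Module.End.mem_eigenspace_iff.2
          (heightOp_of_weight hv.weight)))
    · exact le_iSup₂_of_le (ζ + (k + 1 : ℕ)) (fun h => hne (k + 1) h.symm) le_rfl
  rw [span_sup_eigenspace_eq_top hv] at hle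
  have hdis := Module.End.eigenspaces_iSupIndep (heightOp n F V) η
  exact hu.ne_zero (Submodule.disjoint_def.1 hdis u
    (Module.End.mem_eigenspace_iff.2 (heightOp_of_weight hu.weight)) (hle trivial))

/-- The highest weight of an irreducible module is unique. -/
theorem IsMaximalVector.weight_unique [CharZero F] {μ ν : Fin n → F} {u v : V}
    (hu : IsMaximalVector (unitOp (n := n) (F := F) V) μ u)
    (hv : IsMaximalVector (unitOp (n := n) (F := F) V) ν v) : μ = ν := by
  obtain ⟨k, hk⟩ := hu.exists_height_eq hv
  obtain ⟨l, hl⟩ := hv.exists_height_eq hu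
  have hkl : ((k + l : ℕ) : F) = 0 := by
    push_cast
    linear_combination -hk - hl
  have hk0 : k = 0 := by
    have := Nat.cast_eq_zero.1 hkl
    omega
  subst hk0
  have huη := heightOp_of_weight hu.weight
  have hvη := heightOp_of_weight hv.weight
  rw [Nat.cast_zero, add_zero] at hk
  rw [hk] at huη
  set η := ∑ i : Fin n, ((i : ℕ) : F) * ν i with hη
  have hmem : u ∈ Submodule.span F {v} ⊔ ⨆ k : ℕ, Module.End.eigenspace (heightOp n F V)
      (η + (k + 1 : ℕ)) := by
    rw [hη, span_sup_eigenspace_eq_top hv]; trivial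
  obtain ⟨y, hy, z, hz, hyz⟩ := Submodule.mem_sup.1 hmem
  obtain ⟨a, rfl⟩ := Submodule.mem_span_singleton.1 hy
  have hz0 : z = 0 := by
    have hdis := Module.End.eigenspaces_iSupIndep (heightOp n F V) η
    refine Submodule.disjoint_def.1 hdis z ?_ ?_
    · rw [← eq_sub_iff_add_eq'] at hyz
      rw [hyz]
      exact Submodule.sub_mem _ (Module.End.mem_eigenspace_iff.2 huη)
        (Submodule.smul_mem _ _ (Module.End.mem_eigenspace_iff.2 hvη))
    · have hle : ⨆ k : ℕ, Module.End.eigenspace (heightOp n F V) (η + (k + 1 : ℕ)) ≤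
          ⨆ θ, ⨆ _ : θ ≠ η, Module.End.eigenspace (heightOp n F V) θ :=
        iSup_le fun k => le_iSup₂_of_le (η + (k + 1 : ℕ))
          (by rw [Ne, add_eq_left]; exact Nat.cast_ne_zero.2 k.succ_ne_zero) le_rfl
      exact hle hz
  rw [hz0, add_zero] at hyz
  funext s
  have h1 := hu.weight s
  rw [← hyz, map_smul, hv.weight, smul_comm, hyz, ← sub_eq_zero, ← sub_smul] at h1
  exact (sub_eq_zero.1 ((smul_eq_zero.1 h1).resolve_right hu.ne_zero)).symm

end Irreducible

/-! ### Operators and coefficients on `F[x] ⊗ V` -/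

section Operators

variable {n : ℕ} {F : Type*} [Field F] (V : Type*) [AddCommGroup V] [Module F V]

/-- Multiplication by `x_i` on `F[x] ⊗ V`. -/
noncomputable def mulOp (i : Fin n) : Module.End F (Poly n F ⊗[F] V) :=
  (LinearMap.mulLeft F (MvPolynomial.X i : Poly n F)).rTensor V

/-- The partial derivative `∂_i` on `F[x] ⊗ V`. -/
noncomputable def derivOp (i : Fin n) : Module.End F (Poly n F ⊗[F] V) :=
  (MvPolynomial.pderiv i : Witt n F).toLinearMap.rTensor V

/-- The coefficient, in `V`, of the monomial `x^l` in an element of `F[x] ⊗ V`. -/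
noncomputable def coeffOp (l : Fin n →₀ ℕ) : Poly n F ⊗[F] V →ₗ[F] V :=
  (TensorProduct.lid F V).toLinearMap ∘ₗ (MvPolynomial.lcoeff F l).rTensor V

variable {V}

@[simp] theorem mulOp_tmul (i : Fin n) (p : Poly n F) (v : V) :
    mulOp V i (p ⊗ₜ[F] v) = (MvPolynomial.X i * p) ⊗ₜ[F] v := rfl

@[simp] theorem derivOp_tmul (i : Fin n) (p : Poly n F) (v : V) :
    derivOp V i (p ⊗ₜ[F] v) = (MvPolynomial.pderiv i p) ⊗ₜ[F] v := rfl

@[simp] theorem coeffOp_tmul (l : Fin n →₀ ℕ) (p : Poly n F) (v : V) :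
    coeffOp V l (p ⊗ₜ[F] v) = p.coeff l • v := by
  simp [coeffOp]

theorem mulOp_mulOp (i j : Fin n) (t : Poly n F ⊗[F] V) :
    mulOp V i (mulOp V j t) = mulOp V j (mulOp V i t) := by
  induction t using TensorProduct.induction_on with
  | zero => simp
  | tmul p v => simp [mul_left_comm]
  | add s t hs ht => simp only [map_add, hs, ht]

theorem derivOp_derivOp (i j : Fin n) (t : Poly n F ⊗[F] V) :
    derivOp V i (derivOp V j t) = derivOp V j (derivOp V i t) := by
  induction t using TensorProduct.induction_on with
  | zero => simp
  | tmul p v =>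
    have h : ⁅(MvPolynomial.pderiv i : Witt n F), (MvPolynomial.pderiv j : Witt n F)⁆ = 0 := by
      refine MvPolynomial.derivation_ext fun k => ?_
      simp [Derivation.commutator_apply, MvPolynomial.pderiv_X, Pi.single_apply, apply_ite]
    have h2 := congrArg (fun D : Witt n F => D p) h
    simp only [Derivation.commutator_apply, Derivation.zero_apply, sub_eq_zero] at h2
    simp [h2]
  | add s t hs ht => simp only [map_add, hs, ht]

theorem derivOp_mulOp (i j : Fin n) (t : Poly n F ⊗[F] V) :
    derivOp V i (mulOp V j t) = mulOp V j (derivOp V i t) + if i = j then t else 0 := by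
  induction t using TensorProduct.induction_on with
  | zero => simp
  | tmul p v =>
    by_cases h : i = j
    · subst h; simp [MvPolynomial.pderiv_X, TensorProduct.add_tmul]
    · simp [MvPolynomial.pderiv_X_of_ne (Ne.symm h), h]
  | add s t hs ht => simp only [map_add, hs, ht]; split_ifs <;> abel

theorem coeffOp_mulOp (l : Fin n →₀ ℕ) (i : Fin n) (t : Poly n F ⊗[F] V) :
    coeffOp V l (mulOp V i t) =
      if i ∈ l.support then coeffOp V (l - Finsupp.single i 1) t else 0 := by
  induction t using TensorProduct.induction_on with
  | zero => simp
  | tmul p v => simp only [mulOp_tmul, coeffOp_tmul, MvPolynomial.coeff_X_mul', ite_smul, zero_smul]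
  | add s t hs ht => simp only [map_add, hs, ht]; split_ifs <;> simp

theorem coeffOp_derivOp (l : Fin n →₀ ℕ) (i : Fin n) (t : Poly n F ⊗[F] V) :
    coeffOp V l (derivOp V i t) =
      ((l i : F) + 1) • coeffOp V (l + Finsupp.single i 1) t := by
  induction t using TensorProduct.induction_on with
  | zero => simp
  | tmul p v => simp [MvPolynomial.coeff_pderiv, smul_smul, mul_comm]
  | add s t hs ht => simp only [map_add, hs, ht, smul_add]

theorem equivFinsupp_apply (l : Fin n →₀ ℕ) (t : Poly n F ⊗[F] V) :
    TensorProduct.equivFinsuppOfBasisLeft (MvPolynomial.basisMonomials (Fin n) F) t l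
      = coeffOp V l t := by
  induction t using TensorProduct.induction_on with
  | zero => simp
  | tmul p v =>
    rw [TensorProduct.equivFinsuppOfBasisLeft_apply_tmul_apply, coeffOp_tmul]
    rfl
  | add s t hs ht => simp only [map_add, Finsupp.add_apply, hs, ht]

theorem eq_zero_of_coeffOp {t : Poly n F ⊗[F] V} (h : ∀ l, coeffOp V l t = 0) : t = 0 := by
  apply (TensorProduct.equivFinsuppOfBasisLeft (MvPolynomial.basisMonomials (Fin n) F)).injective
  ext l
  rw [equivFinsupp_apply, h, map_zero, Finsupp.zero_apply]

variable (n F V) in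
/-- The Euler operator `∑ k, x_k ∂_k` on `F[x] ⊗ V`. -/
noncomputable def eulerOp : Module.End F (Poly n F ⊗[F] V) :=
  ∑ k, mulOp V k * derivOp V k

theorem eulerOp_apply (t : Poly n F ⊗[F] V) :
    eulerOp n F V t = ∑ k, mulOp V k (derivOp V k t) := by
  simp [eulerOp, LinearMap.sum_apply]

theorem coeffOp_mulOp_derivOp_self (l : Fin n →₀ ℕ) (i : Fin n) (t : Poly n F ⊗[F] V) :
    coeffOp V l (mulOp V i (derivOp V i t)) = (l i : F) • coeffOp V l t := by
  rw [coeffOp_mulOp, coeffOp_derivOp]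
  split_ifs with h
  · have h1 : 1 ≤ l i := Nat.one_le_iff_ne_zero.2 (Finsupp.mem_support_iff.1 h)
    rw [tsub_add_cancel_of_le (Finsupp.single_le_iff.2 h1), Finsupp.tsub_apply,
      Finsupp.single_eq_same, Nat.cast_sub h1, Nat.cast_one, sub_add_cancel]
  · rw [Finsupp.notMem_support_iff.1 h, Nat.cast_zero, zero_smul]

theorem eulerOp_mulOp (i : Fin n) (t : Poly n F ⊗[F] V) :
    eulerOp n F V (mulOp V i t) = mulOp V i (eulerOp n F V t) + mulOp V i t := by
  simp only [eulerOp_apply, derivOp_mulOp, map_add, Finset.sum_add_distrib, map_sum]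
  congr 1
  · exact Finset.sum_congr rfl fun k _ => mulOp_mulOp k i _
  · simp [apply_ite]

theorem eulerOp_derivOp (i : Fin n) (t : Poly n F ⊗[F] V) :
    eulerOp n F V (derivOp V i t) = derivOp V i (eulerOp n F V t) - derivOp V i t := by
  simp only [eulerOp_apply, map_sum, derivOp_mulOp, Finset.sum_add_distrib]
  simp [derivOp_derivOp i]

theorem eulerOp_of_mem_degPiece [LieRingModule (Matrix (Fin n) (Fin n) F) V]
    [LieModule F (Matrix (Fin n) (Fin n) F) V] {j : ℕ} {t : Poly n F ⊗[F] V}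
    (ht : t ∈ degPiece (F := F) (n := n) V j) : eulerOp n F V t = (j : F) • t := by
  induction ht using Submodule.span_induction with
  | mem t ht =>
    obtain ⟨l, v, hl, rfl⟩ := ht
    have h : ∀ k : Fin n, mulOp V k (derivOp V k
        ((MvPolynomial.monomial l (1 : F) : Poly n F) ⊗ₜ[F] v)) =
        (l k : F) • ((MvPolynomial.monomial l (1 : F) : Poly n F) ⊗ₜ[F] v) := by
      intro k
      rw [derivOp_tmul, mulOp_tmul, MvPolynomial.X_mul_pderiv_monomial, ← Nat.cast_smul_eq_nsmul F,
        TensorProduct.smul_tmul']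
    rw [eulerOp_apply]
    simp only [h]
    rw [← Finset.sum_smul, ← Nat.cast_sum, hl]
  | zero => simp
  | add s t _ _ hs ht => rw [map_add, hs, ht, smul_add]
  | smul a t _ ht => rw [map_smul, ht, smul_comm]

theorem eq_tmul_of_eulerOp_eq_zero [CharZero F] {t : Poly n F ⊗[F] V}
    (ht : eulerOp n F V t = 0) : t = 1 ⊗ₜ[F] coeffOp V 0 t := by
  rw [← sub_eq_zero]
  refine eq_zero_of_coeffOp fun l => ?_
  by_cases hl : l = 0
  · subst hl; simp
  · have h1 := congrArg (coeffOp V l) ht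
    simp only [eulerOp_apply, map_sum, coeffOp_mulOp_derivOp_self, map_zero] at h1
    rw [← Finset.sum_smul, ← Nat.cast_sum] at h1
    have h2 : ∑ i, l i ≠ 0 := fun h => hl (by
      ext i; simpa using (Finset.sum_eq_zero_iff.1 h) i (Finset.mem_univ i))
    rw [map_sub, (smul_eq_zero.1 h1).resolve_left (Nat.cast_ne_zero.2 h2), coeffOp_tmul,
      MvPolynomial.coeff_one, if_neg (Ne.symm hl), zero_smul, sub_zero]

variable (V) [LieRingModule (Matrix (Fin n) (Fin n) F) V]
  [LieModule F (Matrix (Fin n) (Fin n) F) V]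

/-- The matrix unit `E_{a,b}` acting on the factor `V` of `F[x] ⊗ V`. -/
noncomputable def innerOp (a b : Fin n) : Module.End F (Poly n F ⊗[F] V) :=
  (unitOp (n := n) (F := F) V a b).lTensor (Poly n F)

variable {V}

@[simp] theorem innerOp_tmul (a b : Fin n) (p : Poly n F) (v : V) :
    innerOp V a b (p ⊗ₜ[F] v) = p ⊗ₜ[F] unitOp (n := n) (F := F) V a b v := rfl

theorem innerOp_mulOp (a b i : Fin n) (t : Poly n F ⊗[F] V) :
    innerOp V a b (mulOp V i t) = mulOp V i (innerOp V a b t) := by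
  induction t using TensorProduct.induction_on with
  | zero => simp
  | tmul p v => simp
  | add s t hs ht => simp only [map_add, hs, ht]

theorem innerOp_derivOp (a b i : Fin n) (t : Poly n F ⊗[F] V) :
    innerOp V a b (derivOp V i t) = derivOp V i (innerOp V a b t) := by
  induction t using TensorProduct.induction_on with
  | zero => simp
  | tmul p v => simp
  | add s t hs ht => simp only [map_add, hs, ht]

theorem coeffOp_innerOp (l : Fin n →₀ ℕ) (a b : Fin n) (t : Poly n F ⊗[F] V) :
    coeffOp V l (innerOp V a b t) = unitOp (n := n) (F := F) V a b (coeffOp V l t) := by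
  induction t using TensorProduct.induction_on with
  | zero => simp
  | tmul p v => simp
  | add s t hs ht => simp only [map_add, hs, ht]

theorem innerOp_innerOp (a b c d : Fin n) (t : Poly n F ⊗[F] V) :
    innerOp V a b (innerOp V c d t) = innerOp V c d (innerOp V a b t) +
      ((if b = c then innerOp V a d t else 0) - (if d = a then innerOp V c b t else 0)) := by
  induction t using TensorProduct.induction_on with
  | zero => simp
  | tmul p v =>
    simp only [innerOp_tmul]
    rw [unitOp_apply_unitOp, TensorProduct.tmul_add, TensorProduct.tmul_sub]
    split_ifs <;> simp
  | add s t hs ht =>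
    simp only [map_add, hs, ht]
    split_ifs <;> abel

theorem glOp_apply (a b : Fin n) (t : Poly n F ⊗[F] V) :
    glOp V a b t = mulOp V a (derivOp V b t) + innerOp V a b t := by
  induction t using TensorProduct.induction_on with
  | zero => simp
  | tmul p v =>
    have h : ∀ i k : Fin n, MvPolynomial.pderiv i (xd n F a b (MvPolynomial.X k)) =
        if a = i then (if b = k then (1 : Poly n F) else 0) else 0 := by
      intro i k
      by_cases hk : b = k
      · subst hk
        simp [xd, MvPolynomial.pderiv_X, Pi.single_apply]
      · simp [xd, MvPolynomial.pderiv_X_of_ne (Ne.symm hk), hk]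
    simp only [glOp, wittOp, LinearMap.add_apply, LinearMap.sum_apply, TensorProduct.map_tmul, h]
    rw [add_comm]
    congr 1
    rw [Finset.sum_eq_single a (fun i _ hi => by simp [Ne.symm hi]) (by simp),
      Finset.sum_eq_single b (fun i _ hi => by simp [Ne.symm hi]) (by simp)]
    simp
  | add s t hs ht => simp only [map_add, hs, ht]; abel

theorem wittOp_pt_apply (i : Fin n) (t : Poly n F ⊗[F] V) :
    wittOp V (pt n F i) t = ∑ k, mulOp V k (innerOp V i k t)
      + mulOp V i (∑ k, innerOp V k k t) + mulOp V i (eulerOp n F V t) := by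
  rw [eulerOp_apply]
  induction t using TensorProduct.induction_on with
  | zero => simp
  | tmul p v =>
    have h0 : ∀ q : Poly n F, pt n F i q =
        MvPolynomial.X i * ∑ k, MvPolynomial.X k * MvPolynomial.pderiv k q := by
      intro q
      have hs : (∑ k : Fin n, xd n F k k) q = ∑ k : Fin n, xd n F k k q := by
        have := congrFun (map_sum (Derivation.coeFnAddMonoidHom (R := F) (A := Poly n F)
          (M := Poly n F)) (fun k => xd n F k k) Finset.univ) q
        rw [Finset.sum_apply] at this
        exact this
      rw [pt, Derivation.smul_apply, hs]
      simp [xd]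
    have h1 : ∀ k : Fin n, pt n F i (MvPolynomial.X k) = MvPolynomial.X i * MvPolynomial.X k := by
      intro k
      rw [h0, Finset.sum_eq_single k (fun j _ hj => by
        rw [MvPolynomial.pderiv_X_of_ne (Ne.symm hj), mul_zero]) (by simp),
        MvPolynomial.pderiv_X_self, mul_one]
    have h : ∀ a k : Fin n, MvPolynomial.pderiv a (pt n F i (MvPolynomial.X k)) =
        (if a = k then MvPolynomial.X i else 0) +
          (if i = a then (MvPolynomial.X k : Poly n F) else 0) := by
      intro a k
      rw [h1, Derivation.leibniz]
      simp only [MvPolynomial.pderiv_X, Pi.single_apply, smul_eq_mul, mul_ite, mul_one, mul_zero]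
      simp [eq_comm]
    simp only [wittOp, LinearMap.add_apply, LinearMap.sum_apply, TensorProduct.map_tmul, h]
    congr 1
    · simp only [LinearMap.mulLeft_apply, add_mul, TensorProduct.add_tmul,
        Finset.sum_add_distrib, ite_mul, zero_mul, map_sum, innerOp_tmul]
      rw [add_comm]
      congr 1
      · rw [Finset.sum_eq_single i (fun a _ ha => by simp [Ne.symm ha]) (by simp)]
        simp
      · refine Finset.sum_congr rfl fun a _ => ?_
        rw [Finset.sum_eq_single a (fun i _ hi => by simp [Ne.symm hi]) (by simp)]
        simp
    · simp [h0, Finset.mul_sum, TensorProduct.sum_tmul]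
  | add s t hs ht =>
    simp only [map_add, hs, ht, Finset.sum_add_distrib]
    abel

end Operators

/-! ### Pseudo-translations and equivariance of `φ` -/

section Equivariance

variable {n : ℕ} {F : Type*} [Field F] {V : Type*} [AddCommGroup V] [Module F V]
  [LieRingModule (Matrix (Fin n) (Fin n) F) V] [LieModule F (Matrix (Fin n) (Fin n) F) V]

variable (V) in
theorem isGlRep_glOp : IsGlRep (glOp (n := n) (F := F) V) := by
  intro a b c d
  refine LinearMap.ext fun t => ?_
  have h : (((if b = c then glOp (n := n) (F := F) V a d else 0) -
      (if d = a then glOp V c b else 0) : Module.End F (Poly n F ⊗[F] V))) t =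
      (if b = c then mulOp V a (derivOp V d t) + innerOp V a d t else 0) -
      (if d = a then mulOp V c (derivOp V b t) + innerOp V c b t else 0) := by
    rw [LinearMap.sub_apply]
    congr 1 <;> split_ifs <;> simp [glOp_apply]
  rw [LinearMap.add_apply, h]
  simp only [Module.End.mul_apply, glOp_apply, map_add, derivOp_mulOp, innerOp_mulOp,
    innerOp_derivOp, innerOp_innerOp a b c d t, mulOp_mulOp a c, derivOp_derivOp b d]
  split_ifs <;> (try simp only [map_zero]) <;> abel

theorem glOp_mulOp (a b i : Fin n) (t : Poly n F ⊗[F] V) :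
    glOp V a b (mulOp V i t) = mulOp V i (glOp V a b t) + if b = i then mulOp V a t else 0 := by
  simp only [glOp_apply, derivOp_mulOp, innerOp_mulOp, map_add, mulOp_mulOp a i]
  split_ifs <;> (try simp only [map_zero]) <;> abel

theorem glOp_derivOp (a b i : Fin n) (t : Poly n F ⊗[F] V) :
    glOp V a b (derivOp V i t) =
      derivOp V i (glOp V a b t) - if i = a then derivOp V b t else 0 := by
  simp only [glOp_apply, derivOp_mulOp, innerOp_derivOp, map_add, derivOp_derivOp b i]
  split_ifs <;> abel

theorem eulerOp_glOp (a b : Fin n) (t : Poly n F ⊗[F] V) :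
    eulerOp n F V (glOp V a b t) = glOp V a b (eulerOp n F V t) := by
  have h : eulerOp n F V (innerOp V a b t) = innerOp V a b (eulerOp n F V t) := by
    simp only [eulerOp_apply, map_sum, innerOp_mulOp, innerOp_derivOp]
  rw [glOp_apply, glOp_apply, map_add, h, eulerOp_mulOp, eulerOp_derivOp, map_sub,
    sub_add_cancel]

/-- The commutator of the Casimir operator with multiplication by `x_i`. -/
theorem casimir_mulOp (i : Fin n) (t : Poly n F ⊗[F] V) :
    casimir (glOp V) (mulOp V i t) = mulOp V i (casimir (glOp V) t) +
      ((2 : F) • (∑ a, mulOp V a (innerOp V i a t) + mulOp V i (eulerOp n F V t))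
        + (n : F) • mulOp V i t) := by
  have h1 : ∀ a b : Fin n, glOp V a b (glOp V b a (mulOp V i t)) =
      mulOp V i (glOp V a b (glOp V b a t)) +
      ((if b = i then mulOp V a (glOp V b a t) else 0) +
      (if a = i then mulOp V b (glOp V a b t) + mulOp V a t else 0)) := by
    intro a b
    rw [glOp_mulOp, map_add, glOp_mulOp, apply_ite (glOp V a b), map_zero, glOp_mulOp, if_pos rfl,
      add_assoc]
  have h2 : ∀ s : Poly n F ⊗[F] V,
      casimir (glOp V) s = ∑ a : Fin n, ∑ b : Fin n, glOp V a b (glOp V b a s) := by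
    intro s; simp [casimir, LinearMap.sum_apply]
  have h3 : ∑ a, mulOp V a (glOp V i a t) =
      ∑ a, mulOp V a (innerOp V i a t) + mulOp V i (eulerOp n F V t) := by
    simp only [glOp_apply, map_add, Finset.sum_add_distrib, eulerOp_apply, map_sum,
      mulOp_mulOp i]
    abel
  rw [h2, h2]
  simp only [h1, Finset.sum_add_distrib, map_sum]
  rw [← h3]
  congr 1
  have h4 : ∑ a : Fin n, ∑ b : Fin n, (if b = i then mulOp V a (glOp V b a t) else 0)
      = ∑ a, mulOp V a (glOp V i a t) := Finset.sum_congr rfl fun a _ => by simp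
  have h5 : ∑ a : Fin n, ∑ b : Fin n,
      (if a = i then mulOp V b (glOp V a b t) + mulOp V a t else 0)
      = ∑ a, mulOp V a (glOp V i a t) + (n : F) • mulOp V i t := by
    rw [Finset.sum_comm]
    simp only [Finset.sum_ite_eq', Finset.mem_univ, if_true, Finset.sum_add_distrib]
    simp [Nat.cast_smul_eq_nsmul]
  rw [h4, h5, two_smul, add_assoc]

theorem sum_innerOp_self {m : F}
    (hm : ∀ v : V, ∑ k, unitOp (n := n) (F := F) V k k v = m • v) (t : Poly n F ⊗[F] V) :
    ∑ k, innerOp V k k t = m • t := by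
  induction t using TensorProduct.induction_on with
  | zero => simp
  | tmul p v => simp only [innerOp_tmul, ← TensorProduct.tmul_sum, hm, TensorProduct.tmul_smul]
  | add s t hs ht => simp only [map_add, Finset.sum_add_distrib, hs, ht, smul_add]

/-- When the identity matrix acts on `V` by `m`, the pseudo-translation `p_i` is, up to a
multiple of `x_i`, half the commutator of the Casimir operator with `x_i`. -/
theorem two_smul_wittOp_pt {m : F} (hm : ∀ v : V, ∑ k, unitOp (n := n) (F := F) V k k v = m • v)
    (i : Fin n) (t : Poly n F ⊗[F] V) :
    (2 : F) • wittOp V (pt n F i) t = casimir (glOp V) (mulOp V i t)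
      - mulOp V i (casimir (glOp V) t) + (2 * m - n) • mulOp V i t := by
  rw [casimir_mulOp, wittOp_pt_apply, sum_innerOp_self hm, map_smul]
  module

theorem wittOp_pt_comm {m : F} (hm : ∀ v : V, ∑ k, unitOp (n := n) (F := F) V k k v = m • v)
    (i k : Fin n) :
    Commute (wittOp (F := F) V (pt n F i)) (wittOp V (pt n F k)) := by
  -- `p_i = Y_i + x_i S` with `Y_i = ∑ x_j E_{ij}` and `S` the sum of `m` and the Euler operator
  obtain ⟨Y, hY⟩ : ∃ Y : Fin n → Module.End F (Poly n F ⊗[F] V),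
      ∀ i t, Y i t = ∑ j, mulOp V j (innerOp V i j t) :=
    ⟨fun i => ∑ j, mulOp V j * innerOp V i j, fun i t => by simp [LinearMap.sum_apply]⟩
  have hp : ∀ i t, wittOp V (pt n F i) t =
      Y i t + mulOp V i (m • t + eulerOp n F V t) := by
    intro i t
    rw [wittOp_pt_apply, sum_innerOp_self hm, hY, map_add, add_assoc]
  have hYX : ∀ i k t, Y i (mulOp V k t) = mulOp V k (Y i t) := by
    intro i k t
    simp only [hY, innerOp_mulOp, map_sum, mulOp_mulOp k]
  have hEY : ∀ i t, eulerOp n F V (Y i t) = Y i (eulerOp n F V t) + Y i t := by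
    intro i t
    simp only [hY, map_sum, eulerOp_mulOp, Finset.sum_add_distrib]
    simp only [eulerOp_apply, map_sum, innerOp_mulOp, innerOp_derivOp]
  have hYY : ∀ i k t, Y i (Y k t) = Y k (Y i t) + (mulOp V k (Y i t) - mulOp V i (Y k t)) := by
    intro i k t
    have h1 : ∀ j l, mulOp V j (innerOp V i j (mulOp V l (innerOp V k l t))) =
        mulOp V l (innerOp V k l (mulOp V j (innerOp V i j t))) +
        ((if j = k then mulOp V k (mulOp V l (innerOp V i l t)) else 0) -
          (if l = i then mulOp V i (mulOp V j (innerOp V k j t)) else 0)) := by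
      intro j l
      simp only [innerOp_mulOp]
      rw [innerOp_innerOp, map_add, map_add, mulOp_mulOp j l, map_sub, map_sub]
      congr 2
      · split_ifs with hj
        · subst hj; rfl
        · simp
      · split_ifs with hl
        · subst hl; rw [mulOp_mulOp]
        · simp
    simp only [hY, map_sum]
    simp only [h1, Finset.sum_add_distrib, Finset.sum_sub_distrib]
    rw [Finset.sum_comm]
    congr 2
    · rw [Finset.sum_comm]; simp
    · simp
  refine LinearMap.ext fun t => ?_
  simp only [Module.End.mul_apply, hp, map_add, map_smul, eulerOp_mulOp, hYX, hEY, hYY i k t,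
    mulOp_mulOp i k, smul_add]
  abel

theorem prod_ofFn_pow_add_single {R : Type*} [Monoid R] {n : ℕ} (g : Fin n → R)
    (hg : ∀ i k, Commute (g i) (g k)) (l : Fin n → ℕ) (i : Fin n) :
    (List.ofFn fun k => g k ^ (l k + if k = i then 1 else 0)).prod
      = g i * (List.ofFn fun k => g k ^ l k).prod := by
  induction n with
  | zero => exact i.elim0
  | succ n ih =>
    rw [List.ofFn_succ, List.ofFn_succ, List.prod_cons, List.prod_cons]
    refine Fin.cases ?_ (fun i => ?_) i
    · simp [pow_succ', mul_assoc, Fin.succ_ne_zero]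
    · have := ih (fun k => g k.succ) (fun i k => hg _ _) (fun k => l k.succ) i
      simp only [Fin.succ_inj, (Fin.succ_ne_zero i).symm, if_false, add_zero, this]
      rw [← mul_assoc, ((hg 0 i.succ).pow_left (l 0)).eq, mul_assoc]

theorem phiAll_one_tmul (v : V) : phiAll V ((1 : Poly n F) ⊗ₜ[F] v) = 1 ⊗ₜ[F] v := by
  have := phiAll_monomial (n := n) (F := F) V 0 v
  rw [MvPolynomial.monomial_zero', map_one] at this
  rw [this, pPow]
  simp

theorem phiAll_mulOp {m : F} (hm : ∀ v : V, ∑ k, unitOp (n := n) (F := F) V k k v = m • v)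
    (i : Fin n) (t : Poly n F ⊗[F] V) :
    phiAll V (mulOp V i t) = wittOp V (pt n F i) (phiAll V t) := by
  induction t using TensorProduct.induction_on with
  | zero => simp
  | tmul p v =>
    induction p using MvPolynomial.induction_on' with
    | monomial l a =>
      have h1 : (MvPolynomial.monomial l a : Poly n F) ⊗ₜ[F] v
          = a • ((MvPolynomial.monomial l (1 : F) : Poly n F) ⊗ₜ[F] v) := by
        rw [TensorProduct.smul_tmul', MvPolynomial.smul_monomial, smul_eq_mul, mul_one]
      have h2 : mulOp V i ((MvPolynomial.monomial l (1 : F) : Poly n F) ⊗ₜ[F] v)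
          = (MvPolynomial.monomial (l + Finsupp.single i 1) (1 : F) : Poly n F) ⊗ₜ[F] v := by
        rw [mulOp_tmul, mul_comm, MvPolynomial.monomial_add_single, pow_one]
      have h3 : pPow (F := F) V (l + Finsupp.single i 1 : Fin n →₀ ℕ)
          = wittOp V (pt n F i) * pPow V l := by
        rw [pPow, pPow, ← prod_ofFn_pow_add_single _ (wittOp_pt_comm hm)]
        simp [Finsupp.single_apply, eq_comm]
      rw [h1, map_smul, map_smul, map_smul, map_smul, h2, phiAll_monomial, phiAll_monomial, h3,
        Module.End.mul_apply]
    | add p q hp hq => simp only [TensorProduct.add_tmul, map_add, hp, hq]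
  | add s t hs ht => simp only [map_add, hs, ht]

theorem glOp_wittOp_pt [CharZero F] {m : F}
    (hm : ∀ v : V, ∑ k, unitOp (n := n) (F := F) V k k v = m • v)
    (a b i : Fin n) (t : Poly n F ⊗[F] V) :
    glOp V a b (wittOp V (pt n F i) t) = wittOp V (pt n F i) (glOp V a b t)
      + if b = i then wittOp V (pt n F a) t else 0 := by
  have hC : ∀ s, glOp V a b (casimir (glOp V) s) = casimir (glOp V) (glOp V a b s) :=
    fun s => LinearMap.congr_fun ((isGlRep_glOp (F := F) V).commute_casimir a b).eq s
  have h2 : (2 : F) ≠ 0 := two_ne_zero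
  apply smul_right_injective _ h2
  simp only [smul_add, smul_ite, smul_zero, two_smul_wittOp_pt hm]
  rw [← map_smul, two_smul_wittOp_pt hm]
  simp only [map_add, map_sub, map_smul, hC, glOp_mulOp]
  split_ifs <;> (try simp only [map_zero]) <;> module

theorem phiAll_glOp [CharZero F] {m : F}
    (hm : ∀ v : V, ∑ k, unitOp (n := n) (F := F) V k k v = m • v)
    (a b : Fin n) (t : Poly n F ⊗[F] V) :
    phiAll V (glOp V a b t) = glOp V a b (phiAll V t) := by
  induction t using TensorProduct.induction_on with
  | zero => simp
  | tmul p v =>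
    induction p using MvPolynomial.induction_on with
    | C r =>
      have h1 : ∀ w : V, (MvPolynomial.C r : Poly n F) ⊗ₜ[F] w = r • ((1 : Poly n F) ⊗ₜ[F] w) := by
        intro w
        rw [TensorProduct.smul_tmul', MvPolynomial.smul_eq_C_mul, mul_one]
      have h2 : ∀ w : V, glOp V a b ((1 : Poly n F) ⊗ₜ[F] w)
          = 1 ⊗ₜ[F] unitOp (n := n) (F := F) V a b w := by
        intro w
        rw [glOp_apply]
        simp
      simp only [h1, map_smul, h2, phiAll_one_tmul]
    | add p q hp hq => simp only [TensorProduct.add_tmul, map_add, hp, hq]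
    | mul_X p i hp =>
      rw [mul_comm, ← mulOp_tmul, glOp_mulOp, map_add, phiAll_mulOp hm, phiAll_mulOp hm, hp,
        glOp_wittOp_pt hm, apply_ite (phiAll V), map_zero, phiAll_mulOp hm]
  | add s t hs ht => simp only [map_add, hs, ht]

end Equivariance

/-! ### Dominance and the numbers `q_c` -/

section Weights

variable {n : ℕ} {F : Type*} [Field F]

theorem exists_nat_sub_eq {μ : Fin n → F} {j : ℕ} {c : Fin n → ℕ} (hc : c ∈ indexSet μ j)
    {s t : Fin n} (hst : s ≤ t) : ∃ k : ℕ, (μ s + c s) - (μ t + c t) = k := by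
  obtain ⟨t, ht⟩ := t
  induction t with
  | zero =>
    have : s = ⟨0, ht⟩ := le_antisymm hst (Fin.mk_le_of_le_val (Nat.zero_le _))
    exact ⟨0, by rw [this]; simp⟩
  | succ t ih =>
    rcases hst.eq_or_lt with rfl | hlt
    · exact ⟨0, by simp⟩
    · obtain ⟨k, hk⟩ := ih (by omega) (Nat.lt_succ_iff.1 hlt)
      obtain ⟨m, hm, hcm⟩ := hc.2 ⟨t, by omega⟩ ⟨t + 1, ht⟩ rfl
      refine ⟨k + (m - c ⟨t + 1, ht⟩) + c ⟨t, by omega⟩, ?_⟩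
      push_cast [Nat.cast_sub hcm]
      linear_combination hk + hm

/-- For `c ∈ I(μ, j)` the weight `μ + c` is dominant, so the Casimir values that occur in a dual
family of weight `μ + c` are distinct. -/
theorem casimirValue_injective [CharZero F] {μ : Fin n → F} {j : ℕ} {c : Fin n → ℕ}
    (hc : c ∈ indexSet μ j) : Function.Injective fun i : Fin n =>
      casimirValue (fun s => (μ s + (c s : F)) - if i = s then 1 else 0) := by
  have key : ∀ s t : Fin n, s < t →
      casimirValue (fun a => (μ a + (c a : F)) - if s = a then 1 else 0) ≠
        casimirValue (fun a => (μ a + (c a : F)) - if t = a then 1 else 0) := by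
    intro s t hst heq
    obtain ⟨k, hk⟩ := exists_nat_sub_eq hc hst.le
    rw [casimirValue_sub_single (fun a => μ a + (c a : F)),
      casimirValue_sub_single (fun a => μ a + (c a : F))] at heq
    have h2 : (2 : F) * ((k + ((t : ℕ) - s) : ℕ) : F) = 0 := by
      push_cast [Nat.cast_sub (Fin.le_def.1 hst.le)]
      linear_combination -heq - 2 * hk
    have h3 := (mul_eq_zero.1 h2).resolve_left two_ne_zero
    have h4 := Nat.cast_eq_zero.1 h3
    have := Fin.lt_def.1 hst
    omega
  intro s t hst
  rcases lt_trichotomy s t with h | h | h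
  · exact absurd hst (key s t h)
  · exact h
  · exact absurd hst.symm (key t s h)

theorem qCoeff_add_single (μ : Fin n → F) (c : Fin n → ℕ) (r : Fin n) :
    qCoeff μ (fun s => c s + if r = s then 1 else 0) = qCoeff μ c *
      (μ r + (∑ t, μ t) - (((r : ℕ) + 1 : ℕ) : F) + ((c r + 1 : ℕ) : F)) := by
  have h : ∀ s : Fin n, ∏ i ∈ Finset.Icc 1 (c s + if r = s then 1 else 0),
      (μ s + (∑ t, μ t) - (((s : ℕ) + 1 : ℕ) : F) + (i : F)) =
      (∏ i ∈ Finset.Icc 1 (c s), (μ s + (∑ t, μ t) - (((s : ℕ) + 1 : ℕ) : F) + (i : F))) *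
        if r = s then (μ s + (∑ t, μ t) - (((s : ℕ) + 1 : ℕ) : F) + ((c s + 1 : ℕ) : F))
        else 1 := by
    intro s
    split_ifs
    · exact Finset.prod_Icc_succ_top (Nat.le_add_left 1 (c s)) _
    · rw [add_zero, mul_one]
  simp only [qCoeff, h, Finset.prod_mul_distrib, Finset.prod_ite_eq, Finset.mem_univ, if_true]

end Weights

/-! ### The eigenvalue on a maximal vector -/

section Eigenvalue

variable {n : ℕ} {F : Type*} [Field F] {V : Type*} [AddCommGroup V] [Module F V]
  [LieRingModule (Matrix (Fin n) (Fin n) F) V] [LieModule F (Matrix (Fin n) (Fin n) F) V]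

/-- The weight of a maximal vector of `F[x] ⊗ V` exceeds the highest weight of `V` by the
exponent of a monomial. -/
theorem IsMaximalVector.exists_weight_eq [CharZero F]
    [LieModule.IsIrreducible F (Matrix (Fin n) (Fin n) F) V]
    {μ ν : Fin n → F} {v : V} (hv : IsMaximalVector (unitOp (n := n) (F := F) V) μ v)
    {t : Poly n F ⊗[F] V} (ht : IsMaximalVector (glOp V) ν t) :
    ∃ l : Fin n → ℕ, ∀ s, ν s = μ s + l s := by
  set f := TensorProduct.equivFinsuppOfBasisLeft (MvPolynomial.basisMonomials (Fin n) F) t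
  have hft : ∀ l, f l = coeffOp V l t := fun l => equivFinsupp_apply l t
  have hne : f.support.Nonempty := by
    rw [Finsupp.support_nonempty_iff]
    intro h0
    exact ht.ne_zero (eq_zero_of_coeffOp fun l => by rw [← hft, h0, Finsupp.zero_apply])
  -- An exponent `l` of `t` of maximal height: replacing a variable by a later one leaves the
  -- support, so the coefficient at `x^l` is a maximal vector of `V`.
  obtain ⟨l, hl, hmax⟩ := Finset.exists_max_image f.support
    (fun l => ∑ i : Fin n, (i : ℕ) * l i) hne
  have hu : IsMaximalVector (unitOp (n := n) (F := F) V) (fun s => ν s - l s)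
      (coeffOp V l t) := by
    refine ⟨by rw [← hft]; exact Finsupp.mem_support_iff.1 hl, fun a b hab => ?_, fun a => ?_⟩
    · have h1 := congrArg (coeffOp V l) (ht.raise a b hab)
      rw [glOp_apply, map_add, coeffOp_innerOp, map_zero] at h1
      suffices h2 : coeffOp V l (mulOp V a (derivOp V b t)) = 0 by
        rwa [h2, zero_add] at h1
      rw [coeffOp_mulOp, coeffOp_derivOp]
      split_ifs with ha
      · suffices h3 : coeffOp V (l - Finsupp.single a 1 + Finsupp.single b 1) t = 0 by
          rw [h3, smul_zero]
        by_contra h3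
        have h4 := hmax _ (Finsupp.mem_support_iff.2 (by rwa [hft]))
        have h5 : l - Finsupp.single a 1 + Finsupp.single a 1 = l :=
          tsub_add_cancel_of_le (Finsupp.single_le_iff.2
            (Nat.one_le_iff_ne_zero.2 (Finsupp.mem_support_iff.1 ha)))
        generalize l - Finsupp.single a 1 = l' at h4 h5
        rw [← h5] at h4
        simp only [Finsupp.add_apply, mul_add, Finset.sum_add_distrib] at h4
        simp [Finsupp.single_apply] at h4
        exact absurd hab (not_lt.2 h4)
      · rfl
    · have h1 := congrArg (coeffOp V l) (ht.weight a)
      rw [glOp_apply, map_add, coeffOp_innerOp, map_smul, coeffOp_mulOp_derivOp_self] at h1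
      rw [sub_smul, ← h1, add_sub_cancel_left]
  exact ⟨l, fun s => by rw [congrFun (hv.weight_unique hu) s, sub_add_cancel]⟩

/-- The partial derivatives of a maximal vector form a dual family. -/
theorem isDualFamily_derivOp {ν : Fin n → F} {t : Poly n F ⊗[F] V}
    (hr : ∀ a b, a < b → glOp V a b t = 0) (hw : ∀ a, glOp V a a t = ν a • t) :
    IsDualFamily (glOp V) ν (fun i => derivOp V i t) where
  raise i a b hab := by rw [glOp_derivOp, hr a b hab, map_zero, zero_sub]
  weight i a := by
    rw [glOp_derivOp, hw, map_smul, sub_smul]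
    split_ifs with h
    · rw [h, one_smul]
    · rw [zero_smul]

/-- Contracting a dual family with the variables gives a maximal vector (or zero). -/
theorem IsDualFamily.casimir_sum_mulOp {ν : Fin n → F} {d : Fin n → Poly n F ⊗[F] V}
    (h : IsDualFamily (glOp V) ν d) :
    casimir (glOp V) (∑ i, mulOp V i (d i)) = casimirValue ν • ∑ i, mulOp V i (d i) := by
  refine (isGlRep_glOp V).casimir_apply_maximal (fun a => ?_) (fun a b hab => ?_)
  · rw [map_sum, Finset.smul_sum]
    refine Finset.sum_congr rfl fun i _ => ?_
    rw [glOp_mulOp, h.weight, sub_smul, map_sub, map_smul]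
    by_cases hia : a = i
    · subst hia; simp
    · simp [hia, Ne.symm hia]
  · simp only [map_sum, glOp_mulOp, h.raise _ a b hab, Finset.sum_add_distrib, map_neg,
      Finset.sum_neg_distrib, apply_ite (mulOp V _), map_zero]
    simp

/-- On a dual family with scalar Casimir action, contraction with the pseudo-translations is a
multiple of contraction with the variables. -/
theorem IsDualFamily.sum_wittOp_pt [CharZero F] {m : F}
    (hm : ∀ v : V, ∑ k, unitOp (n := n) (F := F) V k k v = m • v)
    {ν : Fin n → F} {d : Fin n → Poly n F ⊗[F] V} (h : IsDualFamily (glOp V) ν d) {r : Fin n}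
    (hC : ∀ i, casimir (glOp V) (d i) =
      casimirValue (fun s => ν s - if r = s then 1 else 0) • d i) :
    ∑ i, wittOp V (pt n F i) (d i) =
      (ν r + m - (((r : ℕ) + 1 : ℕ) : F)) • ∑ i, mulOp V i (d i) := by
  have h2 : (2 : F) ≠ 0 := two_ne_zero
  apply smul_right_injective _ h2
  simp only [Finset.smul_sum (r := (2 : F)) (f := fun i => wittOp V (pt n F i) (d i)),
    two_smul_wittOp_pt hm, hC, map_smul, Finset.sum_add_distrib, Finset.sum_sub_distrib]
  rw [← map_sum, h.casimir_sum_mulOp, ← Finset.smul_sum, ← Finset.smul_sum,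
    casimirValue_sub_single, smul_smul]
  push_cast
  module

theorem eulerOp_commute_glOp (a b : Fin n) :
    Commute (eulerOp n F V) (glOp V a b) :=
  LinearMap.ext fun t => eulerOp_glOp a b t

/-- The eigenvalue of `x^l ⊗ v ↦ p^l (1 ⊗ v)` on a maximal vector of weight `μ + c`. The vector
may vanish, which saves distinctions in the induction on the degree. -/
theorem phiAll_eq_qCoeff_smul [CharZero F]
    [LieModule.IsIrreducible F (Matrix (Fin n) (Fin n) F) V]
    {μ : Fin n → F} {v : V} (hv : IsMaximalVector (unitOp (n := n) (F := F) V) μ v)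
    (j : ℕ) (c : Fin n → ℕ) (hc : c ∈ indexSet μ j) (ξ : Poly n F ⊗[F] V)
    (hdeg : eulerOp n F V ξ = (j : F) • ξ)
    (hr : ∀ a b, a < b → glOp V a b ξ = 0) (hw : ∀ a, glOp V a a ξ = (μ a + (c a : F)) • ξ) :
    phiAll V ξ = qCoeff μ c • ξ := by
  have hm : ∀ w : V, ∑ k, unitOp (n := n) (F := F) V k k w = (∑ k, μ k) • w :=
    sum_unitOp_self hv.ne_zero hv.weight
  have hgl := isGlRep_glOp (n := n) (F := F) V
  induction j generalizing c ξ with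
  | zero =>
    have hc0 : ∀ s, c s = 0 := fun s =>
      (Finset.sum_eq_zero_iff.1 hc.1) s (Finset.mem_univ s)
    have hξ := eq_tmul_of_eulerOp_eq_zero (t := ξ) (by rw [hdeg, Nat.cast_zero, zero_smul])
    rw [hξ, phiAll_one_tmul, qCoeff]
    simp [hc0]
  | succ j ih =>
    have hd := isDualFamily_derivOp (ν := fun s => μ s + (c s : F)) hr hw
    have hinj := casimirValue_injective hc
    obtain ⟨P, hsum, hC⟩ := hd.exists_splitting hgl hinj
    set u : Fin n → Fin n → Poly n F ⊗[F] V :=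
      fun r i => Polynomial.aeval (casimir (glOp V)) (P r) (derivOp V i ξ) with hu
    have hfam : ∀ r, IsDualFamily (glOp V) (fun s => μ s + (c s : F)) (u r) := fun r =>
      hd.map fun a b => commute_aeval (hgl.commute_casimir a b) (P r)
    have hueul : ∀ r i, eulerOp n F V (u r i) = (j : F) • u r i := by
      intro r i
      have h1 := LinearMap.congr_fun
        (commute_aeval (commute_casimir_of_commute (eulerOp_commute_glOp (V := V))) (P r)).eq
        (derivOp V i ξ)
      simp only [Module.End.mul_apply] at h1
      simp only [hu, h1, eulerOp_derivOp, hdeg]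
      rw [← map_smul, map_smul (derivOp V i)]
      congr 1
      push_cast
      module
    have hurr : ∀ r a b, a < b → glOp V a b (u r r) = 0 := by
      intro r a b hab
      rw [(hfam r).raise r a b hab, neg_eq_zero]
      split_ifs with hra
      · exact (hfam r).eq_zero_of_gt hgl hinj (hC r) b (hra ▸ hab)
      · rfl
    have hmain : ∀ r, ∑ i, wittOp V (pt n F i) (phiAll V (u r i)) =
        qCoeff μ c • ∑ i, mulOp V i (u r i) := by
      intro r
      rcases Nat.eq_zero_or_pos (c r) with hcr | hcr
      · -- A nonzero `u r r` would have a weight that does not occur in `F[x] ⊗ V`.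
        have h0 : u r r = 0 := by
          by_contra hne
          obtain ⟨l, hl⟩ := hv.exists_weight_eq (t := u r r) ⟨hne, hurr r, (hfam r).weight r⟩
          have h1 := hl r
          rw [if_pos rfl, hcr, Nat.cast_zero, add_zero] at h1
          have h2 : ((l r + 1 : ℕ) : F) = 0 := by
            push_cast
            linear_combination -h1
          exact absurd (Nat.cast_eq_zero.1 h2) (Nat.succ_ne_zero _)
        have h1 := (hfam r).eq_zero hgl hinj (hC r) h0
        simp [h1]
      · set c' : Fin n → ℕ := fun s => c s - if r = s then 1 else 0 with hc'
        have hcc' : ∀ s, c s = c' s + if r = s then 1 else 0 := by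
          intro s
          simp only [hc']
          split_ifs with hrs
          · subst hrs; omega
          · simp
        have hmem : c' ∈ indexSet μ j := by
          refine ⟨?_, fun s t hst => ?_⟩
          · have h1 := hc.1
            simp only [hcc', Finset.sum_add_distrib, Finset.sum_ite_eq, Finset.mem_univ,
              if_true] at h1
            omega
          · obtain ⟨k, hk, hk2⟩ := hc.2 s t hst
            exact ⟨k, hk, (Nat.sub_le _ _).trans hk2⟩
        have hwt : ∀ a, glOp V a a (u r r) = (μ a + (c' a : F)) • u r r := by
          intro a
          rw [(hfam r).weight r a, hcc' a]
          congr 1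
          push_cast
          ring
        have hrr := ih c' hmem (u r r) (hueul r r) (hurr r) hwt
        have hcomm : ∀ a b, Commute (glOp V a b)
            ((phiAll V : Module.End F (Poly n F ⊗[F] V)) - qCoeff μ c' • 1) := fun a b =>
          LinearMap.ext fun t => by simp [phiAll_glOp hm]
        -- `φ - q` kills `u r r` and commutes with the action, hence kills the whole family.
        have hφ : ∀ i, phiAll V (u r i) = qCoeff μ c' • u r i := by
          intro i
          have h1 := ((hfam r).map hcomm).eq_zero hgl hinj (r := r) (fun i => by
            have h2 := LinearMap.congr_fun (commute_casimir_of_commute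
              fun a b => (hcomm a b).symm).eq (u r i)
            simp only [Module.End.mul_apply] at h2
            rw [← h2, hC r i, map_smul]) (by
              simp [hrr]) i
          simpa [sub_eq_zero] using h1
        have hq : qCoeff μ c = qCoeff μ c' *
            (μ r + (∑ t, μ t) - (((r : ℕ) + 1 : ℕ) : F) + ((c' r + 1 : ℕ) : F)) := by
          rw [← qCoeff_add_single]
          exact congrArg _ (funext hcc')
        simp only [hφ, map_smul]
        rw [← Finset.smul_sum, (hfam r).sum_wittOp_pt hm (hC r), smul_smul, hq]
        congr 2
        rw [hcc' r, if_pos rfl]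
        ring
    have hj : ((j + 1 : ℕ) : F) ≠ 0 := Nat.cast_ne_zero.2 (Nat.succ_ne_zero j)
    apply smul_right_injective _ hj
    change ((j + 1 : ℕ) : F) • phiAll V ξ = ((j + 1 : ℕ) : F) • qCoeff μ c • ξ
    rw [← map_smul, smul_comm, ← hdeg, eulerOp_apply, map_sum]
    calc ∑ i, phiAll V (mulOp V i (derivOp V i ξ))
        = ∑ i, ∑ r, wittOp V (pt n F i) (phiAll V (u r i)) := by
          refine Finset.sum_congr rfl fun i _ => ?_
          rw [phiAll_mulOp hm, ← map_sum, ← map_sum, hsum i]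
      _ = ∑ r, qCoeff μ c • ∑ i, mulOp V i (u r i) := by
          rw [Finset.sum_comm]
          exact Finset.sum_congr rfl fun r _ => hmain r
      _ = qCoeff μ c • ∑ i, mulOp V i (derivOp V i ξ) := by
          rw [← Finset.smul_sum, Finset.sum_comm]
          congr 1
          refine Finset.sum_congr rfl fun i _ => ?_
          rw [← map_sum, hsum i]

end Eigenvalue
end GenProj

theorem lemma3p2p3 {F : Type*} [Field F] [CharZero F] (n : ℕ)
    (V : Type*) [AddCommGroup V] [Module F V]
    [LieRingModule (Matrix (Fin n) (Fin n) F) V] [LieModule F (Matrix (Fin n) (Fin n) F) V]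
    [FiniteDimensional F V] [LieModule.IsIrreducible F (Matrix (Fin n) (Fin n) F) V]
    (μ : Fin n → F) (hμ : ∃ v : V, GenProj.IsMaximalVector (GenProj.unitOp V) μ v)
    (j : ℕ) (c : Fin n → ℕ) (hc : c ∈ GenProj.indexSet μ j)
    (ξ : GenProj.degPiece (F := F) (n := n) V j)
    (hξ : GenProj.IsMaximalVector (GenProj.glOp V) (fun s => μ s + (c s : F))
      (ξ : GenProj.Poly n F ⊗[F] V)) :
    (GenProj.phi V j ξ : GenProj.Poly n F ⊗[F] V)
      = GenProj.qCoeff μ c • (ξ : GenProj.Poly n F ⊗[F] V) := by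
  obtain ⟨v, hv⟩ := hμ
  exact GenProj.phiAll_eq_qCoeff_smul hv j c hc ξ (GenProj.eulerOp_of_mem_degPiece ξ.2)
    hξ.raise hξ.weight
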